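/- Let $p$ be an odd prime, let $m,u$ be positive integers, $q=p^m$, $v=\gcd(m,u)$ and $s=m/2$, and let $\mathrm{Tr}$ be the trace from $\mathbb{F}_q$ to $\mathbb{F}_p$. Put $$D_1=\{(x,y)\in\mathbb{F}_q^2\setminus\{(0,0)\}:\ \mathrm{Tr}(x+y^{p^u+1})=0\},\qquad C_{D_1}=\{(\mathrm{Tr}(ax+by))_{(x,y)\in D_1}:\ a,b\in\mathbb{F}_q\}.$$ If $m/v\equiv 2\pmod 4$, then $C_{D_1}$ is a $[p^{2m-1}-1,\,2m]$ linear code over $\mathbb{F}_p$ (that is, of length $p^{2m-1}-1$ and dimension $2m$), and it is a three-weight code (exactly three positive integers occur as Hamming weights of its codewords). Its weight distribution, where $A_w$ is the number of codewords of Hamming weight $w$, is - $A_0=1$; - $A_w=p^{2m}-1-(p-1)p^m$ for $w=(p-1)p^{2m-2}$; - $A_w=(p-1)(p^{m-1}-p^s+p^{s-1})$ for $w=(p-1)p^{2m-2}\left(1+\frac{1}{p^s}\right)$; - $A_w=(p-1)(p^s+1)(p^s-p^{s-1})$ for $w=(p-1)p^{2m-2}\left(1-\frac{1}{(p-1)p^s}\right)$;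 - $A_w=0$ for all other $w$. -/

import Mathlib

open Finset

/-- The number of codewords of Hamming weight `w` in a linear code `C` over `ZMod p`
whose coordinates are indexed by the finite type `ι`. -/
noncomputable def weightCount {p : ℕ} {ι : Type*} [Fintype ι]
    (C : Submodule (ZMod p) (ι → ZMod p)) (w : ℕ) : ℕ :=
  Set.ncard {c : ι → ZMod p | c ∈ C ∧ hammingNorm c = w}

/-- `C` is an `[n, k]` linear code: it has length `n` and dimension `k`. -/
def IsLinearCode {p : ℕ} {ι : Type*} [Fintype ι]
    (C : Submodule (ZMod p) (ι → ZMod p)) (n k : ℕ) : Prop :=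
  Fintype.card ι = n ∧ Module.finrank (ZMod p) C = k

/-- `C` is a `t`-weight code: exactly `t` of the numbers `A_1, …, A_n` are nonzero,
where `n` is the length of `C` and `A_i` is the number of codewords of weight `i`. -/
def IsWeightCode {p : ℕ} {ι : Type*} [Fintype ι]
    (C : Submodule (ZMod p) (ι → ZMod p)) (t : ℕ) : Prop :=
  #{i ∈ Finset.Icc 1 (Fintype.card ι) | weightCount C i ≠ 0} = t

/-- The codeword `c(a,b) = (Tr(ax+by))_{(x,y) ∈ D}`, with `Tr` the trace from `F` to `ZMod p`. -/
noncomputable def codeword (p : ℕ) {F : Type*} [Field F] [Algebra (ZMod p) F]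
    (D : Finset (F × F)) (a b : F) : D → ZMod p :=
  fun d => Algebra.trace (ZMod p) F (a * d.1.1 + b * d.1.2)

/-- The linear code `C_D = {c(a,b) : a, b ∈ F}` with defining set `D ⊆ F × F`. -/
noncomputable def codeOf (p : ℕ) {F : Type*} [Field F] [Algebra (ZMod p) F]
    (D : Finset (F × F)) : Submodule (ZMod p) (D → ZMod p) where
  carrier := {c | ∃ a b : F, c = codeword p D a b}
  zero_mem' := ⟨0, 0, by funext d; simp [codeword]⟩
  add_mem' := by
    rintro _ _ ⟨a, b, rfl⟩ ⟨a', b', rfl⟩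
    refine ⟨a + a', b + b', ?_⟩
    funext d
    simp only [codeword, Pi.add_apply, ← map_add]
    congr 1
    ring
  smul_mem' := by
    rintro r _ ⟨a, b, rfl⟩
    refine ⟨r • a, r • b, ?_⟩
    funext d
    simp only [codeword, Pi.smul_apply, ← map_smul, smul_add, smul_mul_assoc]

open Classical in
/-- The set of all `(x,y) ≠ (0,0)` in `F × F` with `Tr(x + y^(p^u+1)) = 0`. -/
noncomputable def definingSet (p u : ℕ) (F : Type*) [Field F] [Fintype F]
    [Algebra (ZMod p) F] : Finset (F × F) :=
  {z : F × F | z ≠ (0, 0) ∧ Algebra.trace (ZMod p) F (z.1 + z.2 ^ (p ^ u + 1)) = 0}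

/-! Write Q(y) = Tr(y^(p^u+1)). For fixed y, the condition Tr(x) = -Q(y) cuts out an affine
hyperplane of x. If a is outside F_p, then Tr(x) and Tr(ax) are independent, so every y contributes
equally to the weight of c(a,b). If a = c is in F_p, the weight is p^(m-1) times #{y : cQ(y) ≠
Tr(by)}. For c = 0 and b ≠ 0 this is the generic weight again. For c ≠ 0, completing the square
turns the condition into Q(y) ≠ Q(w), where w depends bijectively on b because the polar form of Q
is nondegenerate (`polarMap_injective`).

It remains to find the fibre sizes of Q (`card_quadTrace_fiber_values`), which is done without
exponential sums. All nonzero values are taken equally often, say B times, since every element of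
F_p^* is a (p^u+1)-th power in F. The first two moments of the fibre sizes give a quadratic equation
with roots B = p^(m-1) ± p^(s-1). The (p^v+1)-th roots of unity act freely on {Q = 1}, so p^v+1
divides B, and this excludes the minus sign. -/

/-- Fibres of a surjective homomorphism of finite groups all have the same size. -/
theorem card_mul_card_fiber_of_surjective {G H T : Type*} [AddGroup G] [Fintype G] [AddGroup H]
    [Fintype H] [DecidableEq H] [FunLike T G H] [AddMonoidHomClass T G H] (f : T)
    (hf : Function.Surjective f) (h : H) :
    Fintype.card H * #{g | f g = h} = Fintype.card G := by
  have key : ∀ k : H, #{g | f g = k} = #{g | f g = h} := fun k =>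
    AddMonoidHom.card_fiber_eq_of_mem_range f (hf k) (hf h)
  have := Finset.card_eq_sum_card_fiberwise (s := (univ : Finset G)) (t := (univ : Finset H))
    (f := f) (fun _ _ => by simp)
  rw [← Finset.card_univ (α := G), this, Finset.sum_congr rfl (fun k _ => key k)]
  simp

/-! ### Trace functionals on F and their fibres -/

section FieldFacts

variable {p : ℕ} {F : Type*} [Field F] [Algebra (ZMod p) F]

theorem trace_algebraMap_mul (c : ZMod p) (x : F) :
    Algebra.trace (ZMod p) F (algebraMap (ZMod p) F c * x) = c * Algebra.trace (ZMod p) F x := by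
  rw [← Algebra.smul_def, map_smul, smul_eq_mul]

/-- Multiplication by `b` followed by the trace. -/
noncomputable def mulTrace (p : ℕ) {F : Type*} [Field F] [Algebra (ZMod p) F] (b : F) :
    F →ₗ[ZMod p] ZMod p :=
  Algebra.traceForm (ZMod p) F b

theorem mulTrace_apply (b x : F) : mulTrace p b x = Algebra.trace (ZMod p) F (b * x) := rfl

variable [Fact p.Prime]

theorem charP_of_algebra_zmod : CharP F p :=
  charP_of_injective_algebraMap (algebraMap (ZMod p) F).injective p

variable [Fintype F]

/-- The `u`-th power of the Frobenius, as an automorphism over the prime field. -/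
noncomputable def frobeniusPow (p : ℕ) [Fact p.Prime] (u : ℕ) (F : Type*) [Field F] [Fintype F]
    [Algebra (ZMod p) F] : F ≃ₐ[ZMod p] F :=
  (FiniteField.frobeniusAlgEquivOfAlgebraic (ZMod p) F) ^ u

theorem frobeniusPow_apply (u : ℕ) (x : F) : frobeniusPow p u F x = x ^ p ^ u := by
  rw [frobeniusPow, AlgEquiv.coe_pow, FiniteField.coe_frobeniusAlgEquivOfAlgebraic_iterate,
    ZMod.card]

theorem trace_frobeniusPow (u : ℕ) (x : F) :
    Algebra.trace (ZMod p) F (frobeniusPow p u F x) = Algebra.trace (ZMod p) F x :=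
  Algebra.trace_eq_of_algEquiv _ x

theorem mulTrace_eq_zero_iff {b : F} : mulTrace p b = 0 ↔ b = 0 := by
  refine ⟨fun h => ?_, fun h => by subst h; ext; simp [mulTrace_apply]⟩
  exact (traceForm_nondegenerate (ZMod p) F).1 b fun y => LinearMap.congr_fun h y

theorem mulTrace_surjective {b : F} (hb : b ≠ 0) : Function.Surjective (mulTrace p b) :=
  LinearMap.surjective (fun h => hb (mulTrace_eq_zero_iff.1 h))

/-- A proper image is killed by some nonzero functional (c, d). Then Tr((c + da)x) = 0 for all x, so
c + da = 0 by nondegeneracy of the trace form, which puts a in the prime field. -/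
theorem mulTrace_prod_surjective {a : F} (ha : a ∉ Set.range (algebraMap (ZMod p) F)) :
    Function.Surjective ((mulTrace p (1 : F)).prod (mulTrace p a)) := by
  by_contra hns
  rw [← LinearMap.range_eq_top, ← Ne, ← lt_top_iff_ne_top] at hns
  obtain ⟨f, f0, hf⟩ := Submodule.exists_le_ker_of_lt_top _ hns
  set c := f (1, 0)
  set d := f (0, 1)
  have hfcd : ∀ z : ZMod p × ZMod p, f z = c * z.1 + d * z.2 := by
    rintro ⟨x, y⟩
    have : ((x, y) : ZMod p × ZMod p) = x • (1, 0) + y • (0, 1) := by simp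
    rw [this, map_add, map_smul, map_smul]
    simp [c, d, mul_comm]
  have h0 : mulTrace p (algebraMap (ZMod p) F c + algebraMap (ZMod p) F d * a) = 0 := by
    ext x
    have : f _ = 0 := hf ⟨x, rfl⟩
    rw [hfcd] at this
    simp only [LinearMap.prod_apply, Function.prod_apply, mulTrace_apply, one_mul] at this
    rw [mulTrace_apply, add_mul, map_add, mul_assoc, trace_algebraMap_mul, trace_algebraMap_mul,
      this, LinearMap.zero_apply]
  rw [mulTrace_eq_zero_iff] at h0
  by_cases hd : d = 0
  · have hc : c = 0 := by simpa [hd] using h0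
    exact f0 (LinearMap.ext fun z => by simp [hfcd, hc, hd])
  · refine ha ⟨-c / d, ?_⟩
    have hd' : algebraMap (ZMod p) F d ≠ 0 := by simpa using hd
    rw [map_div₀, map_neg, div_eq_iff hd']
    linear_combination -h0

variable {m : ℕ}

theorem card_mulTrace_fiber (hF : Fintype.card F = p ^ m) (hm : 0 < m) {b : F} (hb : b ≠ 0)
    (t : ZMod p) : #{x | mulTrace p b x = t} = p ^ (m - 1) := by
  have h := card_mul_card_fiber_of_surjective (mulTrace p b) (mulTrace_surjective hb) t
  rw [ZMod.card, hF] at h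
  refine Nat.eq_of_mul_eq_mul_left (Fact.out : p.Prime).pos (h.trans ?_)
  rw [← pow_succ', Nat.sub_add_cancel hm]

theorem card_mulTrace_prod_fiber (hF : Fintype.card F = p ^ m) (hm : 2 ≤ m) {a : F}
    (ha : a ∉ Set.range (algebraMap (ZMod p) F)) (t t' : ZMod p) :
    #{x | mulTrace p (1 : F) x = t ∧ mulTrace p a x = t'} = p ^ (m - 2) := by
  have h := card_mul_card_fiber_of_surjective _ (mulTrace_prod_surjective ha) (t, t')
  rw [Fintype.card_prod, ZMod.card, hF] at h
  have hpos : 0 < p * p := Nat.mul_pos (Fact.out : p.Prime).pos (Fact.out : p.Prime).pos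
  refine Nat.eq_of_mul_eq_mul_left hpos (Eq.trans ?_ (h.trans ?_))
  · simp [Prod.ext_iff]
  · rw [← pow_two, ← pow_add]
    congr 1; omega

end FieldFacts

/-- `A` is a union of left cosets of `K`. -/
theorem dvd_card_of_smul_stable {G : Type*} [Group G] [Finite G] (K : Subgroup G) (A : Set G)
    (hA : ∀ x ∈ A, ∀ k ∈ K, x * k ∈ A) : Nat.card K ∣ Nat.card A := by
  have h : A = QuotientGroup.mk ⁻¹' ((QuotientGroup.mk : G → G ⧸ K) '' A) := by
    refine subset_antisymm (Set.subset_preimage_image _ _) ?_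
    rintro y ⟨x, hx, hxy⟩
    rw [QuotientGroup.eq] at hxy
    simpa using hA x hx _ hxy
  rw [h, Nat.card_congr (QuotientGroup.preimageMkEquivSubgroupProdSet K _), Nat.card_prod]
  exact Nat.dvd_mul_right _ _

theorem pow_pow_mul_eq_self {M : Type*} [Monoid M] {x : M} {p k : ℕ} (h : x ^ p ^ k = x) (i : ℕ) :
    x ^ p ^ (k * i) = x := by
  induction i with
  | zero => simp
  | succ i ih => rw [mul_add, mul_one, pow_add, pow_mul, ih, h]

/-! ### The quadratic form Q, its polar form and its symmetries -/

section Quad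

variable {p : ℕ} {F : Type*} [Field F] [Algebra (ZMod p) F]

/-- The quadratic form `y ↦ Tr(y^(p^u+1))`. -/
noncomputable def quadTrace (p u : ℕ) {F : Type*} [Field F] [Algebra (ZMod p) F] (y : F) :
    ZMod p :=
  Algebra.trace (ZMod p) F (y ^ (p ^ u + 1))

theorem quadTrace_zero (u : ℕ) : quadTrace p u (0 : F) = 0 := by
  simp [quadTrace]

variable {u v i j : ℕ}

theorem quadTrace_mul {x : F} {t : ZMod p} (hx : x ^ (p ^ u + 1) = algebraMap (ZMod p) F t)
    (y : F) : quadTrace p u (x * y) = t * quadTrace p u y := by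
  rw [quadTrace, mul_pow, hx, trace_algebraMap_mul, quadTrace]

variable [Fact p.Prime] [Fintype F]

/-- The additive map representing the polar form of `quadTrace` through the trace form. -/
noncomputable def polarMap (p : ℕ) [Fact p.Prime] (u : ℕ) (F : Type*) [Field F] [Fintype F]
    [Algebra (ZMod p) F] : F →+ F where
  toFun w := frobeniusPow p u F w + (frobeniusPow p u F).symm w
  map_zero' := by simp
  map_add' x y := by simp only [map_add]; ring

theorem polarMap_apply (u : ℕ) (w : F) :
    polarMap p u F w = frobeniusPow p u F w + (frobeniusPow p u F).symm w := rfl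

/-- The trace is Frobenius-invariant, so the adjoint of a Frobenius power for the trace form is its
inverse. -/
theorem quadTrace_add (u : ℕ) (y w : F) :
    quadTrace p u (y + w) = quadTrace p u y + mulTrace p (polarMap p u F w) y +
      quadTrace p u w := by
  have h : Algebra.trace (ZMod p) F ((frobeniusPow p u F).symm w * y) =
      Algebra.trace (ZMod p) F (w * frobeniusPow p u F y) := by
    rw [← trace_frobeniusPow u, map_mul, AlgEquiv.apply_symm_apply]
  have hpow : ∀ z : F, quadTrace p u z =
      Algebra.trace (ZMod p) F (frobeniusPow p u F z * z) := fun z => by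
    rw [quadTrace, frobeniusPow_apply, pow_succ]
  rw [hpow, hpow, hpow, mulTrace_apply, polarMap_apply, add_mul, map_add _ (_ * y), h,
    ← map_add, ← map_add, ← map_add]
  congr 1
  rw [map_add]
  ring

/-- A kernel element satisfies w^(p^(2u)) = -w. Applying this power map 2j+1 times, an odd number,
gives -w. But 2u(2j+1) = m(2i+1) with m = v(4j+2), so the same iterate is also the identity; hence
2w = 0. -/
theorem polarMap_injective (hp : Odd p) (hF : Fintype.card F = p ^ (v * (4 * j + 2)))
    (hu : u = v * (2 * i + 1)) : Function.Injective (polarMap p u F) := by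
  rw [injective_iff_map_eq_zero]
  intro w hw
  rw [polarMap_apply] at hw
  have h2 : w ^ p ^ (2 * u) = -w := by
    have := congrArg (frobeniusPow p u F) hw
    rw [map_add, AlgEquiv.apply_symm_apply, map_zero, frobeniusPow_apply, frobeniusPow_apply,
      ← pow_mul, ← pow_add, ← two_mul] at this
    exact eq_neg_of_add_eq_zero_left this
  have h4 : w ^ p ^ (4 * u) = w := by
    have : 4 * u = 2 * u + 2 * u := by ring
    rw [this, pow_add, pow_mul, h2, (hp.pow).neg_pow, h2, neg_neg]
  have h6 : w ^ p ^ (2 * u * (2 * j + 1)) = -w := by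
    have : 2 * u * (2 * j + 1) = 4 * u * j + 2 * u := by ring
    rw [this, pow_add, pow_mul, pow_pow_mul_eq_self h4, h2]
  have h7 : w ^ p ^ (2 * u * (2 * j + 1)) = w := by
    have : 2 * u * (2 * j + 1) = v * (4 * j + 2) * (2 * i + 1) := by rw [hu]; ring
    rw [this]
    refine pow_pow_mul_eq_self ?_ _
    rw [← hF]
    exact FiniteField.pow_card w
  have : CharP F p := charP_of_algebra_zmod
  have h20 : (2 : F) ≠ 0 := by
    refine Ring.two_ne_zero ?_
    rw [ringChar.eq F p]
    rintro rfl
    exact absurd hp (by decide)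
  have h8 : (2 : F) * w = 0 := by linear_combination h6 - h7
  exact (mul_eq_zero.1 h8).resolve_left h20

/-- In the cyclic group of units, t has order dividing p-1, so it is a (p^v+1)-th power of some x
with x^((p-1)(p^v+1)) = 1. Such an x lies in the subfield of order p^(2v). As u/v is odd, x^(p^u) =
x^(p^v) there. -/
theorem exists_pow_eq_algebraMap (hF : Fintype.card F = p ^ (v * (4 * j + 2)))
    (hu : u = v * (2 * i + 1)) {t : ZMod p} (ht : t ≠ 0) :
    ∃ x : F, x ≠ 0 ∧ x ^ (p ^ u + 1) = algebraMap (ZMod p) F t := by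
  classical
  have hp1 : 0 < p := (Fact.out : p.Prime).pos
  obtain ⟨k, hk⟩ : (p - 1) * (p ^ v + 1) ∣ p ^ (v * (4 * j + 2)) - 1 := by
    have h1 : p - 1 ∣ p ^ v - 1 := Nat.sub_one_dvd_pow_sub_one p v
    have h2 : (p ^ v - 1) * (p ^ v + 1) = p ^ (v * 2) - 1 := by
      rw [pow_mul, mul_comm, ← Nat.sq_sub_sq, one_pow]
    refine (Nat.mul_dvd_mul_right h1 _).trans ?_
    rw [h2, show v * (4 * j + 2) = v * 2 * (2 * j + 1) by ring, pow_mul p (v * 2)]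
    exact Nat.sub_one_dvd_pow_sub_one _ _
  obtain ⟨h, hh⟩ : p - 1 ∣ p ^ v - 1 := Nat.sub_one_dvd_pow_sub_one p v
  have hcard : Fintype.card Fˣ = (p - 1) * (p ^ v + 1) * k := by
    rw [Fintype.card_units, hF, hk]
  have hkpos : 0 < Fintype.card Fˣ := Fintype.card_pos
  have hp2 : 0 < p - 1 := Nat.pos_of_ne_zero fun h0 => by simp [hcard, h0] at hkpos
  have ht' : algebraMap (ZMod p) F t ≠ 0 := by simpa using ht
  obtain ⟨g, hg⟩ := IsCyclic.exists_generator (α := Fˣ)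
  obtain ⟨l, hl⟩ := (Submonoid.mem_powers_iff _ _).1
    (mem_powers_iff_mem_zpowers.2 (hg (Units.mk0 _ ht')))
  have hord : orderOf g = (p - 1) * (p ^ v + 1) * k := by
    rw [orderOf_eq_card_of_forall_mem_zpowers hg, Nat.card_eq_fintype_card, hcard]
  have htp : (Units.mk0 (algebraMap (ZMod p) F t) ht') ^ (p - 1) = 1 := by
    ext
    rw [Units.val_pow_eq_pow_val, Units.val_mk0, ← map_pow, ZMod.pow_card_sub_one_eq_one ht,
      map_one, Units.val_one]
  rw [← hl, ← pow_mul, ← orderOf_dvd_iff_pow_eq_one, hord, mul_comm l, mul_assoc] at htp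
  obtain ⟨n, hn⟩ := Nat.dvd_of_mul_dvd_mul_left hp2 htp
  have hgo : g ^ ((p - 1) * (p ^ v + 1) * k) = 1 := by rw [← hord, pow_orderOf_eq_one]
  have hpv : 1 ≤ p ^ v := Nat.one_le_pow _ _ hp1
  -- (p-1)(p^v+1) divides p^(2v) - 1, with quotient `h`.
  have hx : (g ^ (k * n)) ^ p ^ (v * 2) = g ^ (k * n) := by
    have : p ^ (v * 2) = (p - 1) * (p ^ v + 1) * h + 1 := by
      have : (p ^ v - 1) * (p ^ v + 1) + 1 = p ^ (v * 2) := by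
        rw [pow_mul, mul_comm, ← Nat.sq_sub_sq, one_pow]
        exact Nat.sub_add_cancel (Nat.one_le_pow _ _ hpv)
      rw [← this, hh]; ring
    rw [← pow_mul, this, show k * n * ((p - 1) * (p ^ v + 1) * h + 1) =
      (p - 1) * (p ^ v + 1) * k * (n * h) + k * n by ring, pow_add, pow_mul, hgo, one_pow, one_mul]
  have hxu : (g ^ (k * n)) ^ p ^ u = (g ^ (k * n)) ^ p ^ v := by
    rw [hu, show v * (2 * i + 1) = v * 2 * i + v by ring, pow_add, pow_mul,
      pow_pow_mul_eq_self hx]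
  refine ⟨(g ^ (k * n) : Fˣ), Units.ne_zero _, ?_⟩
  rw [← Units.val_pow_eq_pow_val, pow_succ, hxu, ← pow_succ, ← pow_mul,
    show k * n * (p ^ v + 1) = (p ^ v + 1) * k * n by ring, ← hn, hl, Units.val_mk0]

theorem card_quadTrace_fiber (hF : Fintype.card F = p ^ (v * (4 * j + 2)))
    (hu : u = v * (2 * i + 1)) {t : ZMod p} (ht : t ≠ 0) :
    #{y : F | quadTrace p u y = t} = #{y : F | quadTrace p u y = 1} := by
  obtain ⟨x, hx0, hx⟩ := exists_pow_eq_algebraMap (F := F) hF hu ht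
  symm
  refine Finset.card_equiv (Equiv.mulLeft₀ x hx0) fun y => ?_
  simp [quadTrace_mul hx, ht]

/-- As u/v is odd, p^v+1 divides p^u+1. Multiplication by a (p^v+1)-th root of unity therefore
preserves Q, and F contains p^v+1 of these roots. -/
theorem dvd_card_quadTrace_fiber (hF : Fintype.card F = p ^ (v * (4 * j + 2)))
    (hu : u = v * (2 * i + 1)) : p ^ v + 1 ∣ #{y : F | quadTrace p u y = 1} := by
  classical
  have hd : p ^ v + 1 ∣ p ^ (v * (4 * j + 2)) - 1 := by
    have h2 : (p ^ v - 1) * (p ^ v + 1) = p ^ (v * 2) - 1 := by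
      rw [pow_mul, mul_comm, ← Nat.sq_sub_sq, one_pow]
    refine (Dvd.intro_left _ h2).trans ?_
    rw [show v * (4 * j + 2) = v * 2 * (2 * j + 1) by ring, pow_mul p (v * 2)]
    exact Nat.sub_one_dvd_pow_sub_one _ _
  have hdu : p ^ v + 1 ∣ p ^ u + 1 := by
    rw [hu, pow_mul]
    simpa using Odd.nat_add_dvd_pow_add_pow (p ^ v) 1 (n := 2 * i + 1) ⟨i, rfl⟩
  have hK : Nat.card (powMonoidHom (p ^ v + 1) : Fˣ →* Fˣ).ker = p ^ v + 1 := by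
    rw [IsCyclic.card_powMonoidHom_ker, Nat.card_eq_fintype_card, Fintype.card_units, hF,
      Nat.gcd_eq_right hd]
  have h := dvd_card_of_smul_stable (powMonoidHom (p ^ v + 1) : Fˣ →* Fˣ).ker
    {y : Fˣ | quadTrace p u (y : F) = 1} ?_
  · rw [hK] at h
    rw [← Nat.card_eq_finsetCard]
    convert h using 1
    symm
    refine Nat.card_congr (Equiv.ofBijective (fun y => ⟨(y.1 : F), by
      rw [mem_filter]; exact ⟨mem_univ _, y.2⟩⟩) ⟨?_, ?_⟩)
    · intro x y hxy
      exact Subtype.ext (Units.ext (congrArg Subtype.val hxy))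
    · rintro ⟨y, hy⟩
      have hy1 : quadTrace p u y = 1 := by simpa using hy
      have hy0 : y ≠ 0 := by
        rintro rfl
        rw [quadTrace_zero] at hy1
        exact zero_ne_one hy1
      exact ⟨⟨Units.mk0 y hy0, hy1⟩, rfl⟩
  · intro x hx k hk
    obtain ⟨e, he⟩ := hdu
    have hk' : k ^ (p ^ v + 1) = 1 := hk
    have hk1 : (k : F) ^ (p ^ u + 1) = algebraMap (ZMod p) F 1 := by
      rw [map_one, he, pow_mul, ← Units.val_pow_eq_pow_val, hk', Units.val_one, one_pow]
    have hx' : quadTrace p u (x : F) = 1 := hx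
    change quadTrace p u ((x * k : Fˣ) : F) = 1
    rw [Units.val_mul, mul_comm, quadTrace_mul hk1, one_mul, hx']

end Quad

/-! ### Fibre sizes of Q from two moments and a divisibility -/

section Count

variable {p : ℕ} [Fact p.Prime] {F : Type*} [Field F] [Fintype F] [Algebra (ZMod p) F]
  {m u v i j s : ℕ}

theorem sum_card_quadTrace_fiber :
    ∑ t : ZMod p, #{y : F | quadTrace p u y = t} = Fintype.card F := by
  rw [← Finset.card_univ (α := F)]
  exact (Finset.card_eq_sum_card_fiberwise fun _ _ => by simp).symm

/-- Q(y+w) - Q(y) is affine in y, with nonzero linear part. -/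
theorem card_quadTrace_add_fiber (hβ : Function.Injective (polarMap p u F))
    (hF : Fintype.card F = p ^ m) (hm : 0 < m) {w : F} (hw : w ≠ 0) :
    #{y : F | quadTrace p u (y + w) = quadTrace p u y} = p ^ (m - 1) := by
  have hb : polarMap p u F w ≠ 0 := fun h => hw (hβ (h.trans (map_zero _).symm))
  rw [← card_mulTrace_fiber hF hm hb (-quadTrace p u w)]
  congr 1
  ext y
  rw [mem_filter, mem_filter, quadTrace_add, eq_neg_iff_add_eq_zero, add_assoc, add_eq_left]

/-- The sum counts pairs (y, z) with Q(y) = Q(z). Sorted by w = z - y, the difference 0 gives p^m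
pairs and every other w gives p^(m-1). -/
theorem sum_sq_card_quadTrace_fiber (hβ : Function.Injective (polarMap p u F))
    (hF : Fintype.card F = p ^ m) (hm : 0 < m) :
    ∑ t : ZMod p, #{y : F | quadTrace p u y = t} ^ 2 = p ^ m + (p ^ m - 1) * p ^ (m - 1) := by
  classical
  have h1 : ∑ t : ZMod p, #{y : F | quadTrace p u y = t} ^ 2 =
      ∑ y : F, #{z : F | quadTrace p u z = quadTrace p u y} := by
    rw [← Finset.sum_fiberwise (univ : Finset F) (quadTrace p u)]
    refine Finset.sum_congr rfl fun t _ => ?_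
    rw [Finset.sum_congr rfl (g := fun _ => #{y : F | quadTrace p u y = t})]
    · rw [Finset.sum_const, smul_eq_mul, sq]
    · intro y hy
      rw [(mem_filter.1 hy).2]
  have h2 : ∀ y : F, #{z : F | quadTrace p u z = quadTrace p u y} =
      #{w : F | quadTrace p u (y + w) = quadTrace p u y} := fun y => by
    symm
    refine Finset.card_equiv (Equiv.addLeft y) fun w => ?_
    simp
  rw [h1, Finset.sum_congr rfl fun y _ => h2 y]
  simp_rw [Finset.card_filter]
  rw [Finset.sum_comm]
  simp_rw [← Finset.card_filter]
  rw [← Finset.add_sum_erase _ _ (mem_univ (0 : F)), Finset.sum_congr rfl fun w hw =>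
    card_quadTrace_add_fiber hβ hF hm (Finset.ne_of_mem_erase hw)]
  simp [hF, Finset.card_erase_of_mem]

theorem card_quadTrace_fiber_values (hp : Odd p) (hv : 0 < v)
    (hF : Fintype.card F = p ^ (v * (4 * j + 2))) (hu : u = v * (2 * i + 1))
    (hs : s = v * (2 * j + 1)) :
    #{y : F | quadTrace p u y = 0} + (p - 1) * p ^ (s - 1) = p ^ (2 * s - 1) ∧
    ∀ t : ZMod p, t ≠ 0 → #{y : F | quadTrace p u y = t} = p ^ (2 * s - 1) + p ^ (s - 1) := by
  have hp3 : 3 ≤ p := by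
    have := (Fact.out : p.Prime).two_le
    obtain ⟨k, rfl⟩ := hp
    omega
  have hs0 : 0 < s := by rw [hs]; positivity
  have hm : v * (4 * j + 2) = 2 * s := by rw [hs]; ring
  obtain ⟨r, rfl⟩ : ∃ r, s = r + 1 := ⟨s - 1, by omega⟩
  have hβ := polarMap_injective hp hF hu
  have hB := fun t ht => card_quadTrace_fiber (F := F) (t := t) hF hu ht
  have hd := dvd_card_quadTrace_fiber hF hu
  have h1 := sum_card_quadTrace_fiber (p := p) (F := F) (u := u)
  have h2 := sum_sq_card_quadTrace_fiber hβ hF (by omega)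
  rw [← Finset.add_sum_erase _ _ (mem_univ (0 : ZMod p)),
    Finset.sum_congr rfl fun t ht => hB t (Finset.ne_of_mem_erase ht)] at h1
  rw [← Finset.add_sum_erase _ _ (mem_univ (0 : ZMod p)), Finset.sum_congr rfl fun t ht =>
    congrArg (· ^ 2) (hB t (Finset.ne_of_mem_erase ht))] at h2
  rw [Finset.sum_const, Finset.card_erase_of_mem (mem_univ _), Finset.card_univ, ZMod.card,
    smul_eq_mul] at h1 h2
  rw [hF] at h1
  rw [hm] at h1 h2
  generalize #{y : F | quadTrace p u y = 0} = A at *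
  generalize #{y : F | quadTrace p u y = 1} = B at *
  have e1 : 2 * (r + 1) - 1 = 2 * r + 1 := by omega
  have e2 : r + 1 - 1 = r := by omega
  rw [e1] at h2 ⊢
  rw [e2]
  have hpm : 1 ≤ p ^ (2 * (r + 1)) := Nat.one_le_pow _ _ (by omega)
  have key : B = p ^ (2 * r + 1) + p ^ r := by
    zify [hpm, (by omega : 1 ≤ p)] at h1 h2 ⊢
    have hp0 : (p : ℤ) * (p - 1) ≠ 0 := by
      have : (3 : ℤ) ≤ p := by exact_mod_cast hp3
      exact mul_ne_zero (by omega) (by omega)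
    have q1 : (p : ℤ) ^ (2 * (r + 1)) = p ^ 2 * (p ^ r) ^ 2 := by ring
    have q2 : (p : ℤ) ^ (2 * r + 1) = p * (p ^ r) ^ 2 := by ring
    rw [q1, q2] at h2
    rw [q1] at h1
    rw [q2]
    have hA : (A : ℤ) = p ^ 2 * (p ^ r) ^ 2 - (p - 1) * B := by linear_combination h1
    rw [hA] at h2
    -- Eliminating A between the two moments leaves (B - p^(2r+1))^2 = p^(2r), up to the factor
    -- p(p-1).
    have he : ((p : ℤ) * (p ^ r) ^ 2 - B - p ^ r) * (p * (p ^ r) ^ 2 - B + p ^ r) = 0 := by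
      refine (mul_eq_zero.1 ?_).resolve_left hp0
      linear_combination h2
    rcases mul_eq_zero.1 he with he | he
    · exfalso
      -- The root to exclude: p^v+1 is prime to p, so it would divide p^s - 1. It also divides p^s +
      -- 1 because s/v is odd, hence it would divide 2.
      have hBe : (B : ℤ) = p ^ r * (p * p ^ r - 1) := by linear_combination -he
      have hd' : ((p ^ v + 1 : ℕ) : ℤ) ∣ (p : ℤ) ^ r * (p * p ^ r - 1) := by
        rw [← hBe]; exact_mod_cast hd
      have hcop : IsCoprime ((p ^ v + 1 : ℕ) : ℤ) ((p : ℤ) ^ r) := by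
        refine IsCoprime.pow_right ⟨1, -(p : ℤ) ^ (v - 1), ?_⟩
        push_cast
        obtain ⟨k, rfl⟩ : ∃ k, v = k + 1 := ⟨v - 1, by omega⟩
        rw [Nat.add_sub_cancel]
        ring
      have hd1 : ((p ^ v + 1 : ℕ) : ℤ) ∣ p * p ^ r - 1 := hcop.dvd_of_dvd_mul_left hd'
      have hd2 : ((p ^ v + 1 : ℕ) : ℤ) ∣ p * p ^ r + 1 := by
        have : p ^ v + 1 ∣ p ^ (r + 1) + 1 := by
          rw [hs, pow_mul]
          simpa using Odd.nat_add_dvd_pow_add_pow (p ^ v) 1 (n := 2 * j + 1) ⟨j, rfl⟩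
        rw [← pow_succ']
        exact_mod_cast this
      have hd3 : ((p ^ v + 1 : ℕ) : ℤ) ∣ ((2 : ℕ) : ℤ) := by
        have e : ((2 : ℕ) : ℤ) = (p * p ^ r + 1) - (p * p ^ r - 1) := by push_cast; ring
        rw [e]
        exact dvd_sub hd2 hd1
      have := Nat.le_of_dvd two_pos (Int.natCast_dvd_natCast.1 hd3)
      have hpv : p ≤ p ^ v := Nat.le_self_pow hv.ne' p
      omega
    · linear_combination -he
  refine ⟨?_, fun t ht => (hB t ht).trans key⟩
  subst key
  zify [(by omega : 1 ≤ p)] at h1 ⊢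
  linear_combination h1

end Count

/-! ### Hamming weights of the codewords -/

section Weight

variable {p : ℕ} {F : Type*} [Field F] [Fintype F] [Algebra (ZMod p) F] {m u : ℕ}

-- Removing (0,0) from the defining set costs nothing, since the coordinate there would vanish.
open Classical in
theorem hammingNorm_codeword [Fact p.Prime] (u : ℕ) (a b : F) :
    hammingNorm (codeword p (definingSet p u F) a b) =
      ∑ y : F, #{x : F | mulTrace p (1 : F) x = -quadTrace p u y ∧
        mulTrace p a x + mulTrace p b y ≠ 0} := by
  have h1 : hammingNorm (codeword p (definingSet p u F) a b) =
      #{z ∈ definingSet p u F | Algebra.trace (ZMod p) F (a * z.1 + b * z.2) ≠ 0} := by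
    rw [hammingNorm, ← Finset.card_map (Function.Embedding.subtype _)]
    congr 1
    ext z
    simp [codeword, and_comm]
  rw [h1, definingSet, Finset.filter_filter]
  simp_rw [Finset.card_filter]
  rw [Fintype.sum_prod_type_right]
  refine Finset.sum_congr rfl fun y _ => Finset.sum_congr rfl fun x _ => ?_
  refine if_congr ?_ rfl rfl
  simp only [mulTrace_apply, one_mul, quadTrace, eq_neg_iff_add_eq_zero, map_add]
  refine ⟨fun h => ⟨h.1.2, h.2⟩, fun h => ⟨⟨?_, h.1⟩, h.2⟩⟩
  rintro hz
  rw [Prod.mk.injEq] at hz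
  exact h.2 (by simp [hz.1, hz.2])

variable [Fact p.Prime]

theorem hammingNorm_codeword_of_notMem (hF : Fintype.card F = p ^ m) (hm : 2 ≤ m) (u : ℕ) {a : F}
    (ha : a ∉ Set.range (algebraMap (ZMod p) F)) (b : F) :
    hammingNorm (codeword p (definingSet p u F) a b) = p ^ m * (p ^ (m - 1) - p ^ (m - 2)) := by
  classical
  rw [hammingNorm_codeword, Finset.sum_congr rfl (g := fun _ => p ^ (m - 1) - p ^ (m - 2))]
  · simp [hF]
  · intro y _
    have h1 := card_mulTrace_fiber hF (by omega) (one_ne_zero (α := F)) (-quadTrace p u y)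
    have h2 := card_mulTrace_prod_fiber hF hm ha (-quadTrace p u y) (-mulTrace p b y)
    have h3 := Finset.card_filter_add_card_filter_not
      (s := ({x : F | mulTrace p (1 : F) x = -quadTrace p u y} : Finset F))
      (fun x => mulTrace p a x = -mulTrace p b y)
    rw [Finset.filter_filter, Finset.filter_filter, h1, h2] at h3
    simp only [ne_eq, ← eq_neg_iff_add_eq_zero]
    omega

/-- Here Tr(cx) = c Tr(x) is already fixed by Tr(x) = -Q(y), so each y contributes its whole
hyperplane or nothing. -/
theorem hammingNorm_codeword_algebraMap (hF : Fintype.card F = p ^ m) (hm : 0 < m) (u : ℕ)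
    (c : ZMod p) (b : F) :
    hammingNorm (codeword p (definingSet p u F) (algebraMap (ZMod p) F c) b) =
      #{y : F | c * quadTrace p u y ≠ mulTrace p b y} * p ^ (m - 1) := by
  classical
  rw [hammingNorm_codeword, Finset.card_filter, Finset.sum_mul]
  refine Finset.sum_congr rfl fun y _ => ?_
  have h1 := card_mulTrace_fiber hF hm (one_ne_zero (α := F)) (-quadTrace p u y)
  have h2 : ∀ x : F, (mulTrace p (1 : F) x = -quadTrace p u y ∧
      mulTrace p (algebraMap (ZMod p) F c) x + mulTrace p b y ≠ 0) ↔
      (mulTrace p (1 : F) x = -quadTrace p u y ∧ c * quadTrace p u y ≠ mulTrace p b y) := by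
    refine fun x => and_congr_right fun hx => not_congr ?_
    rw [mulTrace_apply (algebraMap (ZMod p) F c), trace_algebraMap_mul]
    rw [mulTrace_apply, one_mul] at hx
    rw [hx, mul_neg, neg_add_eq_zero]
  simp_rw [h2]
  by_cases h : c * quadTrace p u y = mulTrace p b y
  · simp [h]
  · simp [h, h1]

theorem hammingNorm_codeword_zero_left (hF : Fintype.card F = p ^ m) (hm : 0 < m) (u : ℕ)
    {b : F} (hb : b ≠ 0) :
    hammingNorm (codeword p (definingSet p u F) 0 b) = (p ^ m - p ^ (m - 1)) * p ^ (m - 1) := by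
  have h := hammingNorm_codeword_algebraMap hF hm u 0 b
  rw [map_zero] at h
  rw [h]
  congr 1
  have h1 := card_mulTrace_fiber hF hm hb 0
  have h3 := Finset.card_filter_add_card_filter_not (s := (univ : Finset F))
      (fun y => mulTrace p b y = 0)
  rw [h1, Finset.card_univ, hF] at h3
  simp only [zero_mul, ne_eq, eq_comm (a := (0 : ZMod p))]
  omega

/-- Completing the square: with this b, the equation cQ(y) = Tr(by) becomes Q(y+w) = Q(w), and y ↦
y+w is a bijection. -/
theorem hammingNorm_codeword_polarMap (hF : Fintype.card F = p ^ m) (hm : 0 < m) (u : ℕ)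
    {c : ZMod p} (hc : c ≠ 0) (w : F) :
    hammingNorm (codeword p (definingSet p u F) (algebraMap (ZMod p) F c)
      (algebraMap (ZMod p) F (-c) * polarMap p u F w)) =
      (p ^ m - #{y : F | quadTrace p u y = quadTrace p u w}) * p ^ (m - 1) := by
  rw [hammingNorm_codeword_algebraMap hF hm]
  congr 1
  have h2 : #{y : F | c * quadTrace p u y =
      mulTrace p (algebraMap (ZMod p) F (-c) * polarMap p u F w) y} =
      #{y : F | quadTrace p u y = quadTrace p u w} := by
    refine Finset.card_equiv (Equiv.addRight w) fun y => ?_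
    rw [mem_filter, mem_filter, Equiv.coe_addRight, quadTrace_add, mulTrace_apply, mul_assoc,
      trace_algebraMap_mul, ← mulTrace_apply, add_eq_right, neg_mul, ← mul_neg,
      mul_right_inj' hc, ← eq_neg_iff_add_eq_zero]
    simp
  have h3 := Finset.card_filter_add_card_filter_not (s := (univ : Finset F))
      (fun y => c * quadTrace p u y =
        mulTrace p (algebraMap (ZMod p) F (-c) * polarMap p u F w) y)
  rw [h2, Finset.card_univ, hF] at h3
  simp only [ne_eq]
  omega

end Weight

/-! ### Length, dimension and weight counts through the encoding map -/

section Code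

variable {p : ℕ} {F : Type*} [Field F] [Algebra (ZMod p) F]

/-- The encoding map `(a,b) ↦ c(a,b)` of the code `C_D`. -/
noncomputable def encode (D : Finset (F × F)) : F × F →ₗ[ZMod p] (D → ZMod p) where
  toFun z := codeword p D z.1 z.2
  map_add' z z' := by
    funext d
    simp only [codeword, Pi.add_apply, ← map_add, Prod.fst_add, Prod.snd_add]
    congr 1
    ring
  map_smul' r z := by
    funext d
    simp only [codeword, Pi.smul_apply, Prod.smul_fst, Prod.smul_snd, smul_mul_assoc, ← smul_add,
      map_smul, RingHom.id_apply]

theorem encode_apply (D : Finset (F × F)) (z : F × F) :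
    encode D z = codeword p D z.1 z.2 := rfl

theorem codeOf_eq_range_encode (D : Finset (F × F)) :
    codeOf p D = LinearMap.range (encode (p := p) D) := by
  ext c
  constructor
  · rintro ⟨a, b, rfl⟩
    exact ⟨(a, b), rfl⟩
  · rintro ⟨z, rfl⟩
    exact ⟨z.1, z.2, rfl⟩

variable [Fintype F]

theorem weightCount_codeOf {D : Finset (F × F)} (hD : Function.Injective (encode (p := p) D))
    (w : ℕ) : weightCount (codeOf p D) w = #{z : F × F | hammingNorm (encode (p := p) D z) = w} := by
  rw [weightCount, ← Set.ncard_coe_finset, ← Set.ncard_image_of_injective _ hD]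
  congr 1
  ext c
  rw [codeOf_eq_range_encode]
  constructor
  · rintro ⟨⟨z, rfl⟩, h⟩
    exact ⟨z, by simpa using h, rfl⟩
  · rintro ⟨z, h, rfl⟩
    exact ⟨⟨z, rfl⟩, by simpa using h⟩

theorem finrank_eq_of_card [Fact p.Prime] {m : ℕ} (hF : Fintype.card F = p ^ m) :
    Module.finrank (ZMod p) F = m := by
  have h := Module.card_eq_pow_finrank (K := ZMod p) (V := F)
  rw [hF, ZMod.card] at h
  exact (Nat.pow_right_injective (Fact.out : p.Prime).two_le h).symm

theorem finrank_codeOf [Fact p.Prime] {D : Finset (F × F)}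
    (hD : Function.Injective (encode (p := p) D)) {m : ℕ} (hF : Fintype.card F = p ^ m) :
    Module.finrank (ZMod p) (codeOf p D) = 2 * m := by
  rw [codeOf_eq_range_encode, LinearMap.finrank_range_of_inj hD, Module.finrank_prod,
    finrank_eq_of_card hF, two_mul]

theorem card_definingSet [Fact p.Prime] {m : ℕ} (hF : Fintype.card F = p ^ m) (hm : 0 < m)
    (u : ℕ) : #(definingSet p u F) = p ^ (2 * m - 1) - 1 := by
  classical
  have h : definingSet p u F =
      ({z : F × F | Algebra.trace (ZMod p) F (z.1 + z.2 ^ (p ^ u + 1)) = 0} :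
        Finset (F × F)).erase (0, 0) := by
    ext z
    simp [definingSet]
  have h2 : #{z : F × F | Algebra.trace (ZMod p) F (z.1 + z.2 ^ (p ^ u + 1)) = 0} =
      p ^ (2 * m - 1) := by
    rw [Finset.card_filter, Fintype.sum_prod_type_right]
    simp_rw [← Finset.card_filter]
    rw [Finset.sum_congr rfl (g := fun _ => p ^ (m - 1))]
    · rw [Finset.sum_const, Finset.card_univ, hF, smul_eq_mul, ← pow_add]
      congr 1; omega
    · intro y _
      rw [← card_mulTrace_fiber hF hm (one_ne_zero (α := F)) (-quadTrace p u y)]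
      simp [mulTrace_apply, quadTrace, eq_neg_iff_add_eq_zero]
  rw [h, Finset.card_erase_of_mem (by simp), h2]

theorem isWeightCode_of_weightCount_eq_zero {ι : Type*} [Fintype ι]
    {C : Submodule (ZMod p) (ι → ZMod p)} {S : Finset ℕ} (h0 : 0 ∉ S)
    (hS : ∀ w ∈ S, weightCount C w ≠ 0) (hn : ∀ w, w ≠ 0 → w ∉ S → weightCount C w = 0) :
    IsWeightCode C #S := by
  rw [IsWeightCode]
  congr 1
  ext w
  rw [mem_filter, mem_Icc]
  constructor
  · rintro ⟨⟨h1, -⟩, h2⟩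
    by_contra h
    exact h2 (hn w (by omega) h)
  · intro h
    refine ⟨⟨Nat.one_le_iff_ne_zero.2 fun h1 => h0 (h1 ▸ h), ?_⟩, hS w h⟩
    obtain ⟨c, -, rfl⟩ := Set.nonempty_of_ncard_ne_zero (hS w h)
    exact hammingNorm_le_card_fintype

end Code

/-! ### Classification of the pairs (a,b) by weight -/

section Distribution

variable {p : ℕ} [Fact p.Prime] {F : Type*} [Field F] [Fintype F] [Algebra (ZMod p) F] {m u : ℕ}

theorem eq_zero_or_hammingNorm_encode (hβ : Function.Injective (polarMap p u F))
    (hF : Fintype.card F = p ^ m) (hm : 2 ≤ m) (z : F × F) :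
    z = 0 ∨ hammingNorm (encode (p := p) (definingSet p u F) z) =
        p ^ m * (p ^ (m - 1) - p ^ (m - 2)) ∨
      ∃ (c : ZMod p) (w : F), c ≠ 0 ∧
        z = (algebraMap (ZMod p) F c, algebraMap (ZMod p) F (-c) * polarMap p u F w) := by
  obtain ⟨a, b⟩ := z
  by_cases ha : a ∈ Set.range (algebraMap (ZMod p) F)
  · obtain ⟨c, rfl⟩ := ha
    by_cases hc : c = 0
    · subst hc
      by_cases hb : b = 0
      · left; simp [hb]
      · right; left
        rw [encode_apply, map_zero, hammingNorm_codeword_zero_left hF (by omega) u hb]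
        obtain ⟨k, rfl⟩ : ∃ k, m = k + 2 := ⟨m - 2, by omega⟩
        rw [show k + 2 - 1 = k + 1 by omega, show k + 2 - 2 = k by omega, Nat.mul_sub, Nat.sub_mul]
        congr 1
        ring
    · right; right
      obtain ⟨w, hw⟩ := (Finite.injective_iff_surjective.1 hβ) (b / algebraMap (ZMod p) F (-c))
      refine ⟨c, w, hc, ?_⟩
      rw [hw, mul_div_cancel₀]
      simpa using hc
  · right; left
    exact hammingNorm_codeword_of_notMem hF hm u ha b

/-- Away from 0 and the generic weight, only the pairs with a in F_p^* remain, and (c, w)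
parametrizes them bijectively. -/
theorem card_hammingNorm_encode (hβ : Function.Injective (polarMap p u F))
    (hF : Fintype.card F = p ^ m) (hm : 2 ≤ m) {W : ℕ} (hW : W ≠ 0)
    (hW1 : W ≠ p ^ m * (p ^ (m - 1) - p ^ (m - 2))) :
    #{z : F × F | hammingNorm (encode (p := p) (definingSet p u F) z) = W} =
      (p - 1) * #{w : F | (p ^ m - #{y : F | quadTrace p u y = quadTrace p u w}) *
        p ^ (m - 1) = W} := by
  classical
  have hc : #{c : ZMod p | c ≠ 0} = p - 1 := by
    rw [Finset.filter_ne' univ (0 : ZMod p), Finset.card_erase_of_mem (mem_univ _),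
      Finset.card_univ, ZMod.card]
  rw [← hc, ← Finset.card_product]
  symm
  refine Finset.card_bij (fun x _ => (algebraMap (ZMod p) F x.1,
    algebraMap (ZMod p) F (-x.1) * polarMap p u F x.2)) ?_ ?_ ?_
  · rintro ⟨c, w⟩ h
    simp only [mem_product, mem_filter, mem_univ, true_and] at h ⊢
    rw [encode_apply, hammingNorm_codeword_polarMap hF (by omega) u h.1, h.2]
  · rintro ⟨c, w⟩ h ⟨c', w'⟩ h' heq
    simp only [mem_product, mem_filter, mem_univ, true_and] at h
    simp only [Prod.mk.injEq] at heq
    obtain rfl := (algebraMap (ZMod p) F).injective heq.1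
    have hc0 : algebraMap (ZMod p) F (-c) ≠ 0 := by simpa using h.1
    rw [hβ (mul_left_cancel₀ hc0 heq.2)]
  · intro z hz
    simp only [mem_filter, mem_univ, true_and] at hz
    rcases eq_zero_or_hammingNorm_encode hβ hF hm z with rfl | h | ⟨c, w, hc, rfl⟩
    · exact absurd (hz.symm.trans (by simp)) hW
    · exact absurd (hz.symm.trans h) hW1
    · refine ⟨(c, w), ?_, rfl⟩
      rw [encode_apply, hammingNorm_codeword_polarMap hF (by omega) u hc] at hz
      simp [hc, hz]

end Distribution

/-! ### Assembly of the weight distribution -/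

theorem theorem3 (p : ℕ) [Fact p.Prime] (hp : Odd p) (m u v s : ℕ) (hm : 0 < m) (hu : 0 < u)
    (hv : v = Nat.gcd m u) (hs : m = 2 * s) (hmv : m / v ≡ 2 [MOD 4])
    (F : Type*) [Field F] [Fintype F] [Algebra (ZMod p) F] (hF : Fintype.card F = p ^ m) :
    IsLinearCode (codeOf p (definingSet p u F)) (p ^ (2 * m - 1) - 1) (2 * m) ∧
    IsWeightCode (codeOf p (definingSet p u F)) 3 ∧
    ∃ w₁ w₂ w₃ : ℕ,
      (w₁ : ℚ) = (p - 1) * p ^ (2 * m - 2) ∧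
      (w₂ : ℚ) = (p - 1) * p ^ (2 * m - 2) * (1 + 1 / p ^ s) ∧
      (w₃ : ℚ) = (p - 1) * p ^ (2 * m - 2) * (1 - 1 / ((p - 1) * p ^ s)) ∧
      weightCount (codeOf p (definingSet p u F)) 0 = 1 ∧
      (weightCount (codeOf p (definingSet p u F)) w₁ : ℚ) =
        p ^ (2 * m) - 1 - (p - 1) * p ^ m ∧
      (weightCount (codeOf p (definingSet p u F)) w₂ : ℚ) =
        (p - 1) * (p ^ (m - 1) - p ^ s + p ^ (s - 1)) ∧
      (weightCount (codeOf p (definingSet p u F)) w₃ : ℚ) =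
        (p - 1) * (p ^ s + 1) * (p ^ s - p ^ (s - 1)) ∧
      ∀ w : ℕ, w ≠ 0 → w ≠ w₁ → w ≠ w₂ → w ≠ w₃ →
        weightCount (codeOf p (definingSet p u F)) w = 0 := by
  classical
  have hp3 : 3 ≤ p := by
    have := (Fact.out : p.Prime).two_le
    obtain ⟨k, rfl⟩ := hp
    omega
  have hv0 : 0 < v := hv ▸ Nat.gcd_pos_of_pos_left u hm
  obtain ⟨i, j, hui, hmj⟩ : ∃ i j, u = v * (2 * i + 1) ∧ m = v * (4 * j + 2) := by
    have hvm : v * (m / v) = m := Nat.mul_div_cancel' (hv ▸ Nat.gcd_dvd_left m u)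
    have hvu : v * (u / v) = u := Nat.mul_div_cancel' (hv ▸ Nat.gcd_dvd_right m u)
    have hcop : Nat.Coprime (m / v) (u / v) := by
      rw [hv]; exact Nat.coprime_div_gcd_div_gcd (hv ▸ hv0)
    have hmod : m / v % 4 = 2 := hmv
    -- m/v is even and coprime to u/v.
    have hodd : u / v % 2 = 1 := by
      by_contra h
      have h2 : 2 ∣ Nat.gcd (m / v) (u / v) := Nat.dvd_gcd (by omega) (by omega)
      rw [hcop] at h2
      omega
    refine ⟨u / v / 2, m / v / 4, ?_, ?_⟩
    · rw [show 2 * (u / v / 2) + 1 = u / v by omega, hvu]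
    · rw [show 4 * (m / v / 4) + 2 = m / v by omega, hvm]
  have hsj : s = v * (2 * j + 1) := by
    have : 2 * s = 2 * (v * (2 * j + 1)) := by rw [← hs, hmj]; ring
    omega
  have hF' := hF
  rw [hmj] at hF'
  have hβ : Function.Injective (polarMap p u F) := polarMap_injective hp hF' hui
  obtain ⟨hN0, hN1⟩ := card_quadTrace_fiber_values hp hv0 hF' hui hsj
  obtain ⟨r, rfl⟩ : ∃ r, s = r + 1 := ⟨s - 1, by omega⟩
  clear hmv hv hmj hF' hui hsj
  subst hs
  set N := #{y : F | quadTrace p u y = 0} with hN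
  have e1 : 2 * (r + 1) - 1 = 2 * r + 1 := by omega
  have e2 : 2 * (r + 1) - 2 = 2 * r := by omega
  have e3 : 2 * (2 * (r + 1)) - 2 = 4 * r + 2 := by omega
  rw [e1, Nat.add_sub_cancel] at hN0 hN1
  rw [e1, e3, Nat.add_sub_cancel]
  set R := p ^ r with hR
  have hR1 : 1 ≤ R := Nat.one_le_pow _ _ (by omega)
  have q0 : p ^ (2 * r) = R ^ 2 := by rw [hR]; ring
  have q1 : p ^ (2 * r + 1) = p * R ^ 2 := by rw [hR]; ring
  have q2 : p ^ (2 * (r + 1)) = p ^ 2 * R ^ 2 := by rw [hR]; ring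
  -- From here t = p - 1 and R = p^(s-1), which removes most truncated subtractions.
  obtain ⟨t, rfl⟩ : ∃ t, p = t + 1 := ⟨p - 1, by omega⟩
  rw [Nat.add_sub_cancel] at hN0
  rw [q1] at hN0 hN1
  have hNpos : 0 < N := Finset.card_pos.2 ⟨0, by simp [quadTrace_zero]⟩
  set W₁ := (t + 1) ^ (2 * (r + 1)) * ((t + 1) ^ (2 * (r + 1) - 1) - (t + 1) ^ (2 * (r + 1) - 2))
    with hW₁
  set W₂ := ((t + 1) ^ (2 * (r + 1)) - N) * (t + 1) ^ (2 * (r + 1) - 1) with hW₂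
  set W₃ := ((t + 1) ^ (2 * (r + 1)) - ((t + 1) * R ^ 2 + R)) * (t + 1) ^ (2 * (r + 1) - 1)
    with hW₃
  rw [e1, e2, q0, q1, q2] at hW₁
  rw [e1, q1, q2] at hW₂ hW₃
  have ht2 : 2 ≤ t := by omega
  have ht0 : 0 < t := by omega
  set K := (t + 1) * R ^ 2 with hK
  have hKpos : 0 < K := by positivity
  -- Each weight is a multiple of K = p^(m-1). The cofactors of W₃, W₁, W₂ are t(t+1)R^2 - R,
  -- t(t+1)R^2 and t(t+1)R^2 + tR, hence distinct. Moreover d₂ = p^m - N is the number of w with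
  -- Q(w) ≠ 0.
  obtain ⟨d₂, hd₂⟩ : ∃ d, d = t * (t + 1) * R ^ 2 + t * R := ⟨_, rfl⟩
  obtain ⟨d₃, hd₃⟩ : ∃ d, d + R = t * (t + 1) * R ^ 2 := by
    refine ⟨t * (t + 1) * R ^ 2 - R, Nat.sub_add_cancel ?_⟩
    calc R ≤ R ^ 2 := Nat.le_self_pow two_ne_zero R
      _ ≤ t * (t + 1) * R ^ 2 := Nat.le_mul_of_pos_left _ (by positivity)
  have hcompl : (t + 1) ^ 2 * R ^ 2 - N = d₂ := by
    refine Nat.sub_eq_of_eq_add ?_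
    rw [hd₂]; linarith
  have f₁ : W₁ = t * (t + 1) * R ^ 2 * K := by
    rw [hW₁, hK, show (t + 1) * R ^ 2 - R ^ 2 = t * R ^ 2 from Nat.sub_eq_of_eq_add (by ring)]
    ring
  have f₂ : W₂ = d₂ * K := by rw [hW₂, hcompl]
  have f₃ : W₃ = d₃ * K := by
    rw [hW₃]
    congr 1
    refine Nat.sub_eq_of_eq_add ?_
    rw [hK]; linarith
  have htR : 0 < t * R := by positivity
  have hd₃pos : 0 < d₃ := by
    have : 2 * R ≤ t * (t + 1) * R ^ 2 := by
      rw [sq, ← mul_assoc]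
      refine Nat.mul_le_mul_right R (ht2.trans ?_)
      rw [mul_assoc]
      exact Nat.le_mul_of_pos_right t (by positivity)
    omega
  have g1 : W₁ ≠ 0 := by rw [f₁]; positivity
  have g2 : W₂ ≠ 0 := by rw [f₂]; exact Nat.mul_ne_zero (by omega) hKpos.ne'
  have g3 : W₃ ≠ 0 := by rw [f₃]; exact Nat.mul_ne_zero (by omega) hKpos.ne'
  have g12 : W₂ ≠ W₁ := fun h => by
    rw [f₁, f₂] at h
    have := Nat.eq_of_mul_eq_mul_right hKpos h
    omega
  have g13 : W₃ ≠ W₁ := fun h => by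
    rw [f₁, f₃] at h
    have := Nat.eq_of_mul_eq_mul_right hKpos h
    omega
  have g23 : W₃ ≠ W₂ := fun h => by
    rw [f₂, f₃] at h
    have := Nat.eq_of_mul_eq_mul_right hKpos h
    omega
  have hval : ∀ w : F, ((t + 1) ^ (2 * (r + 1)) -
      #{y : F | quadTrace (t + 1) u y = quadTrace (t + 1) u w}) * (t + 1) ^ (2 * (r + 1) - 1) =
      if quadTrace (t + 1) u w = 0 then W₂ else W₃ := fun w => by
    rw [e1, q1, q2]
    split_ifs with h
    · rw [h, hW₂]
    · rw [hN1 _ h, hW₃]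
  have hm2 : 2 ≤ 2 * (r + 1) := by omega
  have hclass := eq_zero_or_hammingNorm_encode hβ hF hm2
  have hmem : ∀ z : F × F, z ≠ 0 →
      hammingNorm (encode (p := t + 1) (definingSet (t + 1) u F) z) ∈
        ({W₁, W₂, W₃} : Finset ℕ) := fun z hz => by
    rcases hclass z with h | h | ⟨c, w, hc, rfl⟩
    · exact absurd h hz
    · rw [h]; exact Finset.mem_insert_self _ _
    · rw [encode_apply, hammingNorm_codeword_polarMap hF hm u hc, hval]
      split_ifs <;> simp
  have h0S : (0 : ℕ) ∉ ({W₁, W₂, W₃} : Finset ℕ) := by simp [g1.symm, g2.symm, g3.symm]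
  have hinj : Function.Injective (encode (p := t + 1) (definingSet (t + 1) u F)) := by
    rw [injective_iff_map_eq_zero]
    intro z hz
    by_contra hz0
    have := hmem z hz0
    rw [hz, hammingNorm_zero] at this
    exact h0S this
  have c0 : #{z : F × F | hammingNorm (encode (p := t + 1) (definingSet (t + 1) u F) z) = 0} =
      1 := by
    rw [Finset.card_eq_one]
    refine ⟨0, ?_⟩
    ext z
    simp [hammingNorm_eq_zero, map_eq_zero_iff _ hinj]
  have c2 : #{z : F × F | hammingNorm (encode (p := t + 1) (definingSet (t + 1) u F) z) = W₂} =
      t * N := by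
    rw [card_hammingNorm_encode hβ hF hm2 g2 g12, Nat.add_sub_cancel, hN]
    simp_rw [hval]
    congr 2
    ext w
    by_cases h : quadTrace (t + 1) u w = 0 <;> simp [h, g23]
  have c3 : #{z : F × F | hammingNorm (encode (p := t + 1) (definingSet (t + 1) u F) z) = W₃} =
      t * d₂ := by
    rw [card_hammingNorm_encode hβ hF hm2 g3 g13, Nat.add_sub_cancel]
    simp_rw [hval]
    rw [← hcompl, ← q2, ← hF, ← Finset.card_univ, hN,
      ← Finset.card_sdiff_of_subset (Finset.subset_univ _)]
    congr 2
    ext w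
    by_cases h : quadTrace (t + 1) u w = 0 <;> simp [h, g23.symm]
  -- The number of pairs of weight W₁ is what the other classes leave of all p^(2m) pairs.
  have htot : 1 + (#{z : F × F | hammingNorm (encode (p := t + 1) (definingSet (t + 1) u F) z) =
      W₁} + (t * N + t * d₂)) = ((t + 1) ^ 2 * R ^ 2) ^ 2 := by
    have h := Finset.card_eq_sum_card_fiberwise (s := (univ : Finset (F × F)))
      (t := ({0, W₁, W₂, W₃} : Finset ℕ))
      (f := fun z => hammingNorm (encode (p := t + 1) (definingSet (t + 1) u F) z)) (by
        intro z _
        by_cases hz : z = 0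
        · simp [hz]
        · exact Finset.mem_insert_of_mem (hmem z hz))
    rw [Finset.sum_insert h0S, Finset.sum_insert (by simp [g12.symm, g13.symm]),
      Finset.sum_insert (by simp [g23.symm]), Finset.sum_singleton, c0, c2, c3, Finset.card_univ,
      Fintype.card_prod, hF, q2] at h
    rw [sq, h]
  have cn : ∀ w : ℕ, w ≠ 0 → w ∉ ({W₁, W₂, W₃} : Finset ℕ) →
      weightCount (codeOf (t + 1) (definingSet (t + 1) u F)) w = 0 := fun w hw0 hw => by
    rw [weightCount_codeOf hinj, Finset.card_eq_zero, Finset.filter_eq_empty_iff]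
    rintro z - rfl
    refine hw (hmem z ?_)
    rintro rfl
    simp at hw0
  have hRq : (R : ℚ) ≠ 0 := by positivity
  have htq : (t : ℚ) ≠ 0 := by positivity
  have htq1 : (t : ℚ) + 1 ≠ 0 := by positivity
  have r0 : ((t : ℚ) + 1) ^ r = R := by rw [hR]; push_cast; rfl
  have r1 : ((t : ℚ) + 1) ^ (r + 1) = (t + 1) * R := by rw [pow_succ', r0]
  have r2 : ((t : ℚ) + 1) ^ (2 * (r + 1)) = (t + 1) ^ 2 * R ^ 2 := by
    rw [mul_comm 2, pow_mul, r1]; ring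
  have r3 : ((t : ℚ) + 1) ^ (2 * r + 1) = (t + 1) * R ^ 2 := by
    rw [pow_succ, mul_comm 2, pow_mul, r0]; ring
  have r4 : ((t : ℚ) + 1) ^ (4 * r + 2) = (t + 1) ^ 2 * R ^ 4 := by
    rw [pow_add, mul_comm 4, pow_mul, r0]; ring
  have r5 : ((t : ℚ) + 1) ^ (2 * (2 * (r + 1))) = ((t + 1) ^ 2 * R ^ 2) ^ 2 := by
    rw [mul_comm 2 (2 * (r + 1)), pow_mul, r2]
  have hKq : (K : ℚ) = (t + 1) * R ^ 2 := by rw [hK]; push_cast; ring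
  have hd₂q : (d₂ : ℚ) = t * (t + 1) * R ^ 2 + t * R := by rw [hd₂]; push_cast; ring
  have hd₃q : (d₃ : ℚ) + R = t * (t + 1) * R ^ 2 := by exact_mod_cast hd₃
  have hNq : (N : ℚ) + t * R = (t + 1) * R ^ 2 := by rw [← hKq]; exact_mod_cast hN0
  refine ⟨⟨?_, finrank_codeOf hinj hF⟩, ?_, W₁, W₂, W₃, ?_, ?_, ?_, ?_, ?_, ?_, ?_, ?_⟩
  · rw [Fintype.card_coe, card_definingSet hF hm]
  · have hS : #({W₁, W₂, W₃} : Finset ℕ) = 3 := by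
      rw [Finset.card_eq_three]
      exact ⟨W₁, W₂, W₃, g12.symm, g13.symm, g23.symm, rfl⟩
    rw [← hS]
    refine isWeightCode_of_weightCount_eq_zero h0S (fun w hw => ?_) cn
    rw [weightCount_codeOf hinj]
    simp only [Finset.mem_insert, Finset.mem_singleton] at hw
    rcases hw with rfl | rfl | rfl
    -- The pair (0,1) has the generic weight W₁.
    · refine (Finset.card_pos.2 ⟨(0, 1), ?_⟩).ne'
      rw [mem_filter, encode_apply, hammingNorm_codeword_zero_left hF hm u one_ne_zero, e1, q1, q2,
        f₁]
      refine ⟨mem_univ _, congrArg (· * K) (Nat.sub_eq_of_eq_add ?_)⟩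
      rw [hK]; ring
    · rw [c2]; positivity
    · rw [c3]; exact Nat.mul_ne_zero (by omega) (by omega)
  · rw [f₁]
    push_cast
    rw [r4, hKq]
    ring
  · rw [f₂]
    push_cast
    rw [r1, r4, hKq, hd₂q, add_sub_cancel_right]
    field_simp
  · rw [f₃]
    push_cast
    rw [r1, r4, hKq, eq_sub_of_add_eq hd₃q, add_sub_cancel_right]
    field_simp
  · rw [weightCount_codeOf hinj, c0]
  · rw [weightCount_codeOf hinj]
    push_cast
    rw [r2, r5]
    have htotq := congrArg (Nat.cast : ℕ → ℚ) htot
    push_cast at htotq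
    rw [hd₂q, eq_sub_of_add_eq hNq] at htotq
    linear_combination htotq
  · rw [weightCount_codeOf hinj, c2]
    push_cast
    rw [r0, r1, r3]
    linear_combination (t : ℚ) * hNq
  · rw [weightCount_codeOf hinj, c3]
    push_cast
    rw [r0, r1, hd₂q]
    ring
  · intro w hw0 hw1 hw2 hw3
    exact cn w hw0 (by simp [hw1, hw2, hw3])
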